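/- Let $X=\{x_0,x_1\}$, and let $X^*$ be the set of words over $X$. Let $(\mathbb C\langle\langle X\rangle\rangle,\sqcup\!\sqcup,1_{X^*})$ be the algebra of noncommutative formal power series over $X$ with complex coefficients, equipped with the shuffle product $\sqcup\!\sqcup$, and let $\mathbb C\langle X\rangle$ be its subalgebra of noncommutative polynomials. For a series $S$ with zero constant term put $S^*=\sum_{k\ge 0}S^k$ (powers for concatenation), and let $$\mathcal A=(\mathbb C\langle X\rangle,\sqcup\!\sqcup,1_{X^*})[x_0^*,(-x_0)^*,x_1^*]$$ be the subalgebra of $(\mathbb C\langle\langle X\rangle\rangle,\sqcup\!\sqcup,1_{X^*})$ generated by $\mathbb C\langle X\rangle$ and the three series $x_0^*$, $(-x_0)^*$, $x_1^*$. Let $\Omega=\mathbb C\setminus(\,]-\infty,0]\cup[1,+\infty[\,)$ and let $\mathcal H(\Omega)$ be the algebra of analytic functions on $\Omega$ with pointwise operations. For $w\in X^*$ let $\operatorname{Li}_w$ be the polylogarithm on $\Omega$ given by $\operatorname{Li}_{x_0^n}(z)=\log^n(z)/n!$ for $n\ge 0$ (principal logarithm), and, with integrals along the segment from $0$ to $z$,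 $$\operatorname{Li}_{x_0w}(z)=\int_0^z\operatorname{Li}_w(s)\,\frac{ds}{s}\quad(\text{if } x_1 \text{ occurs in } w),\qquad \operatorname{Li}_{x_1w}(z)=\int_0^z\operatorname{Li}_w(s)\,\frac{ds}{1-s}.$$ Then there exists a unique morphism of unital $\mathbb C$-algebras $\mu:\mathcal A\to\mathcal H(\Omega)$ such that 1. $\mu(w)=\operatorname{Li}_w$ for every word $w\in X^*$ (in particular, each $\operatorname{Li}_w$ is analytic on $\Omega$), 2. $\mu(x_0^*)$ is the function $z\mapsto z$, 3. $\mu((-x_0)^*)$ is the function $z\mapsto 1/z$, 4. $\mu(x_1^*)$ is the function $z\mapsto 1/(1-z)$. -/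

import Mathlib

noncomputable section

namespace Polylog

/-! ### Noncommutative series in two letters, with the shuffle product -/

/-- The alphabet `X = {x₀, x₁}`; the letter `xᵢ` is `i : Fin 2`. -/
abbrev Letter : Type := Fin 2

/-- The noncommutative formal power series `ℂ⟨⟨X⟩⟩`: a series `S` is the function
sending a word `w` to its coefficient `⟨S | w⟩`. -/
def Series : Type := List Letter → ℂ

namespace Series

instance : AddCommGroup Series := inferInstanceAs (AddCommGroup (List Letter → ℂ))

instance : Module ℂ Series := inferInstanceAs (Module ℂ (List Letter → ℂ))

@[ext] theorem ext {S T : Series} (h : ∀ w, S w = T w) : S = T := funext h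

@[simp] theorem add_apply (S T : Series) (w : List Letter) : (S + T) w = S w + T w := rfl

@[simp] theorem zero_apply (w : List Letter) : (0 : Series) w = 0 := rfl

@[simp] theorem smul_apply (c : ℂ) (S : Series) (w : List Letter) : (c • S) w = c * S w := rfl

/-- The word `w`, seen as a series. -/
def word (w : List Letter) : Series := fun v => if v = w then 1 else 0

/-- All `2 ^ |w|` ways of splitting the word `w` into a subword and the complementary subword;
that is, the terms of the coproduct `Δ(w)` dual to the shuffle product. -/
def splits : List Letter → List (List Letter × List Letter)
  | [] => [([], [])]
  | a :: w =>
      (splits w).map (fun p => (a :: p.1, p.2)) ++ (splits w).map (fun p => (p.1, a :: p.2))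

/-- The shuffle product of series: the coefficient of `w` is the sum of `⟨S | u⟩ ⟨T | v⟩` over all
ways of obtaining `w` by shuffling a word `u` with a word `v`. -/
def shuffle (S T : Series) : Series :=
  fun w => ((splits w).map (fun p => S p.1 * T p.2)).sum

instance : One Series := ⟨word []⟩

/-- The multiplication of the ring `Series` is the shuffle product. -/
instance : Mul Series := ⟨shuffle⟩

/-- `S ↦ (w ↦ ⟨S | a w⟩)`. -/
def lder (a : Letter) (S : Series) : Series := fun w => S (a :: w)

theorem mul_nil (S T : Series) : (S * T) [] = S [] * T [] := by
  change ((splits []).map (fun p => S p.1 * T p.2)).sum = _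
  simp [splits]

theorem mul_cons (S T : Series) (a : Letter) (w : List Letter) :
    (S * T) (a :: w) = (lder a S * T) w + (S * lder a T) w := by
  change ((splits (a :: w)).map (fun p => S p.1 * T p.2)).sum
    = ((splits w).map (fun p => lder a S p.1 * T p.2)).sum
      + ((splits w).map (fun p => S p.1 * lder a T p.2)).sum
  simp [splits, List.map_append, List.sum_append, List.map_map, Function.comp_def, lder]

theorem lder_mul (S T : Series) (a : Letter) :
    lder a (S * T) = lder a S * T + S * lder a T := by
  ext w
  exact mul_cons S T a w

theorem lder_add (S T : Series) (a : Letter) : lder a (S + T) = lder a S + lder a T := rfl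

theorem lder_smul (c : ℂ) (S : Series) (a : Letter) : lder a (c • S) = c • lder a S := rfl

theorem lder_zero (a : Letter) : lder a (0 : Series) = 0 := rfl

theorem lder_one (a : Letter) : lder a (1 : Series) = 0 := by
  ext w
  change (if a :: w = [] then (1 : ℂ) else 0) = 0
  simp

protected theorem mul_comm' (S T : Series) : S * T = T * S := by
  ext w
  induction w generalizing S T with
  | nil => rw [mul_nil, mul_nil, mul_comm]
  | cons a w ih => rw [mul_cons, mul_cons, ih, ih S, add_comm]

protected theorem add_mul' (S T U : Series) : (S + T) * U = S * U + T * U := by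
  ext w
  induction w generalizing S T U with
  | nil => simp only [mul_nil, add_apply, add_mul]
  | cons a w ih =>
    simp only [mul_cons, add_apply, lder_add, ih]
    ring

protected theorem mul_add' (S T U : Series) : S * (T + U) = S * T + S * U := by
  rw [Series.mul_comm', Series.add_mul', Series.mul_comm' T, Series.mul_comm' U]

protected theorem mul_assoc' (S T U : Series) : S * T * U = S * (T * U) := by
  ext w
  induction w generalizing S T U with
  | nil => simp only [mul_nil, mul_assoc]
  | cons a w ih =>
    simp only [mul_cons, add_apply, lder_mul, Series.add_mul', Series.mul_add', ih]
    ring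

protected theorem smul_mul' (c : ℂ) (S T : Series) : (c • S) * T = c • (S * T) := by
  ext w
  induction w generalizing S T with
  | nil => simp only [mul_nil, smul_apply, mul_assoc]
  | cons a w ih => simp only [mul_cons, smul_apply, lder_smul, ih, mul_add]

protected theorem zero_mul' (S : Series) : 0 * S = 0 := by
  have h := Series.smul_mul' 0 0 S
  rwa [zero_smul, zero_smul] at h

protected theorem one_mul' (S : Series) : 1 * S = S := by
  ext w
  induction w generalizing S with
  | nil =>
    rw [mul_nil]
    change (if ([] : List Letter) = [] then (1 : ℂ) else 0) * S [] = S []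
    simp
  | cons a w ih =>
    rw [mul_cons, lder_one, Series.zero_mul', ih]
    simp [lder]

/-- The shuffle algebra `(ℂ⟨⟨X⟩⟩, ⧢, 1)`. -/
instance : CommRing Series :=
  { (inferInstance : AddCommGroup Series) with
    mul := (· * ·)
    one := 1
    mul_assoc := Series.mul_assoc'
    mul_comm := Series.mul_comm'
    one_mul := Series.one_mul'
    mul_one := fun S => by rw [Series.mul_comm', Series.one_mul']
    left_distrib := Series.mul_add'
    right_distrib := Series.add_mul'
    zero_mul := Series.zero_mul'
    mul_zero := fun S => by rw [Series.mul_comm', Series.zero_mul'] }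

instance : Algebra ℂ Series :=
  Algebra.ofModule Series.smul_mul'
    (fun c S T => by rw [Series.mul_comm', Series.smul_mul', Series.mul_comm'])

/-! ### Concatenation and the star of a series -/

/-- The concatenation (Cauchy) product: `⟨ST | w⟩ = ∑_{uv = w} ⟨S | u⟩ ⟨T | v⟩`. -/
def conc (S T : Series) : Series :=
  fun w => ∑ i ∈ Finset.range (w.length + 1), S (w.take i) * T (w.drop i)

/-- Powers for the concatenation product. -/
def concPow (S : Series) : ℕ → Series
  | 0 => word []
  | k + 1 => conc S (concPow S k)

/-- The star `S* = ∑_{k ≥ 0} S ^ k` (concatenation powers) of a series with zero constant term.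
For such `S`, the powers with `k > |w|` do not contribute to the coefficient of `w`, so
the sum defining that coefficient stops at `k = |w|`. -/
def seriesStar (S : Series) : Series :=
  fun w => ∑ k ∈ Finset.range (w.length + 1), concPow S k w

/-- The letter `xᵢ`, seen as a series. -/
def letter (i : Letter) : Series := word [i]

/-- The noncommutative polynomials `ℂ⟨X⟩`: the series with finitely many nonzero coefficients. -/
def polynomials : Set Series := {S | {w | S w ≠ 0}.Finite}

/-- The shuffle algebra `(ℂ⟨X⟩, ⧢, 1)[x₀*, (-x₀)*, x₁*]`: the subalgebra of `(ℂ⟨⟨X⟩⟩, ⧢, 1)`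
generated by `ℂ⟨X⟩` and the three series `x₀*`, `(-x₀)*`, `x₁*`. -/
def extAlgebra : Subalgebra ℂ Series :=
  Algebra.adjoin ℂ (polynomials ∪ {seriesStar (letter 0), seriesStar (-letter 0), seriesStar (letter 1)})

theorem word_mem_extAlgebra (w : List Letter) : word w ∈ extAlgebra := by
  refine Algebra.subset_adjoin (Or.inl ?_)
  refine (Set.finite_singleton w).subset fun v hv => ?_
  by_contra h
  exact hv (if_neg h)

end Series

open Series

/-- The word `w` in `ℂ⟨X⟩[x₀*, (-x₀)*, x₁*]`. -/
def wordE (w : List Letter) : extAlgebra := ⟨word w, word_mem_extAlgebra w⟩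

/-- `x₀*` in `ℂ⟨X⟩[x₀*, (-x₀)*, x₁*]`. -/
def x0star : extAlgebra :=
  ⟨seriesStar (letter 0), Algebra.subset_adjoin (Or.inr (by simp))⟩

/-- `(-x₀)*` in `ℂ⟨X⟩[x₀*, (-x₀)*, x₁*]`. -/
def negx0star : extAlgebra :=
  ⟨seriesStar (-letter 0), Algebra.subset_adjoin (Or.inr (by simp))⟩

/-- `x₁*` in `ℂ⟨X⟩[x₀*, (-x₀)*, x₁*]`. -/
def x1star : extAlgebra :=
  ⟨seriesStar (letter 1), Algebra.subset_adjoin (Or.inr (by simp))⟩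

/-! ### Analytic functions on the cleft plane, and polylogarithms -/

/-- The cleft plane `Ω = ℂ - (]-∞, 0] ∪ [1, +∞[)`. -/
def Omega : Set ℂ := {z | ¬ (z.im = 0 ∧ (z.re ≤ 0 ∨ 1 ≤ z.re))}

/-- The algebra `H(Ω)` of analytic functions on `Ω`, with pointwise operations. -/
def HOmega : Subalgebra ℂ (Omega → ℂ) where
  carrier := {f | ∃ g : ℂ → ℂ, AnalyticOnNhd ℂ g Omega ∧ ∀ z : Omega, f z = g z}
  mul_mem' := by
    rintro f₁ f₂ ⟨g₁, h₁, e₁⟩ ⟨g₂, h₂, e₂⟩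
    exact ⟨g₁ * g₂, h₁.mul h₂, fun z => by simp [e₁, e₂]⟩
  add_mem' := by
    rintro f₁ f₂ ⟨g₁, h₁, e₁⟩ ⟨g₂, h₂, e₂⟩
    exact ⟨g₁ + g₂, h₁.add h₂, fun z => by simp [e₁, e₂]⟩
  algebraMap_mem' := fun c => ⟨fun _ => c, analyticOnNhd_const, fun _ => rfl⟩

/-- The integral `∫₀ᶻ g(s) ds` along the segment from `0` to `z`. For `z ∈ Ω` the
segment lies in `Ω`, apart from its end point `0`. -/
def segmentIntegral (g : ℂ → ℂ) (z : ℂ) : ℂ := ∫ t in (0 : ℝ)..1, g (t * z) * z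

/-- The polylogarithm `Li_w` of a word `w`, as an iterated integral of `ω₀ = ds / s` and
`ω₁ = ds / (1 - s)`, the leftmost letter of `w` giving the outermost integration:
`Li_{x₀ⁿ}(z) = logⁿ(z) / n!`, `Li_{x₀ w}(z) = ∫₀ᶻ Li_w(s) ds / s` if `x₁` occurs in `w`, and
`Li_{x₁ w}(z) = ∫₀ᶻ Li_w(s) ds / (1 - s)`. It is used for `z ∈ Ω`;
`log` is the principal logarithm. -/
def Li : List Letter → ℂ → ℂ
  | [], _ => 1
  | a :: w, z =>
      if a = 1 then segmentIntegral (fun s => Li w s / (1 - s)) z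
      else if (1 : Letter) ∈ w then segmentIntegral (fun s => Li w s / s) z
      else Complex.log z ^ (w.length + 1) / ((w.length + 1).factorial : ℂ)

end Polylog

end

open Polylog Polylog.Series

noncomputable section

namespace Polylog

/-! ### Letter derivatives of series -/

namespace Series

/-! Existence rests on an algebraic fact and an analytic one.

Algebra: the shuffle powers (x₀*)^k (x₁*)^l, with k ∈ ℤ and l ∈ ℕ, are linearly independent over the
polynomials; negative k makes sense because (-x₀)* is the shuffle inverse of x₀*. Deleting a given
first letter is a derivation of the shuffle product. The combination ∂₀ + i∂₁ is locally nilpotent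
on polynomials and multiplies (x₀*)^k (x₁*)^l by k + il, so polynomial multiples of different powers
lie in different, hence independent, generalized eigenspaces (`evalStars_injective`). A morphism can
therefore be prescribed freely: any algebra morphism on polynomials together with any monoid
morphism on the exponents, here (k, l) ↦ z^k (1 - z)^(-l).

Analysis: w ↦ Li_w turns shuffles into products (`LiPol_mul_wordP`). By induction on |u| + |v|, the
function Li_u Li_v - Li_{u ⧢ v} has zero derivative. If x₁ occurs in u or v, it tends to 0 along
segments towards 0, so it vanishes; otherwise only powers of log are involved. Convergence of the
integrals, their analyticity and the limit at 0 all come from the power bounds `ScaleBound`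
(`hasDerivAt_segmentIntegral`, `Li_regularity`).

Uniqueness holds because the polynomials, spanned by words, and the three stars generate the
algebra. -/

theorem ext_lder {S T : Series} (h : S [] = T []) (hl : ∀ a, lder a S = lder a T) : S = T := by
  ext w
  cases w with
  | nil => exact h
  | cons a w => exact congrFun (hl a) w

theorem one_nil : (1 : Series) [] = 1 :=
  show (if ([] : List Letter) = [] then (1 : ℂ) else 0) = 1 from if_pos rfl

theorem one_cons (a : Letter) (w : List Letter) : (1 : Series) (a :: w) = 0 :=
  show (if a :: w = [] then (1 : ℂ) else 0) = 0 from if_neg (by simp)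

theorem word_nil : word [] = 1 := rfl

theorem lder_word_cons (a b : Letter) (w : List Letter) :
    lder a (word (b :: w)) = if a = b then word w else 0 := by
  ext v
  by_cases h : a = b <;> simp [lder, word, h]

/-! ### The star of a multiple of a letter -/

/-- Only the cut after the first letter contributes, because `letter a` is supported on a single
word of length one. -/
theorem conc_letter_cons (c : ℂ) (a : Letter) (T : Series) (b : Letter) (w : List Letter) :
    conc (c • letter a) T (b :: w) = if b = a then c * T w else 0 := by
  unfold conc
  rw [Finset.sum_eq_single 1]
  · by_cases h : b = a <;> simp [letter, word, h]
  · intro i hi hne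
    have hl : (b :: w).take i ≠ [a] := by
      intro h
      have := congrArg List.length h
      simp only [List.length_take, List.length_cons, List.length_nil, Finset.mem_range] at this hi
      omega
    simp only [smul_apply, letter, word, if_neg hl, mul_zero, zero_mul]
  · simp

theorem star_letter_nil (c : ℂ) (a : Letter) : seriesStar (c • letter a) [] = 1 := by
  simp [seriesStar, concPow, word]

/-- This is S* = 1 + S S* read on first letters. The truncations agree: the term k = 0 vanishes on
`b :: w`, and shifting k leaves exactly the range belonging to `w`. -/
theorem lder_star_letter (c : ℂ) (a b : Letter) :
    lder b (seriesStar (c • letter a)) = if b = a then c • seriesStar (c • letter a) else 0 := by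
  ext w
  change ∑ k ∈ Finset.range (w.length + 1 + 1), concPow (c • letter a) k (b :: w) = _
  rw [Finset.sum_range_succ']
  have h0 : concPow (c • letter a) 0 (b :: w) = 0 := by simp [concPow, word]
  rw [h0]
  simp only [add_zero, concPow, conc_letter_cons]
  split_ifs with h
  · rw [smul_apply, seriesStar, Finset.mul_sum]
  · simp

/-- The constant term is 1, and in the Leibniz rule the eigenvalues c and -c cancel. -/
theorem star_letter_mul_star_neg (c : ℂ) (a : Letter) :
    seriesStar (c • letter a) * seriesStar (-c • letter a) = 1 := by
  refine ext_lder ?_ fun b => ?_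
  · rw [mul_nil, star_letter_nil, star_letter_nil, one_nil, mul_one]
  · rw [lder_mul, lder_star_letter, lder_star_letter, lder_one]
    split_ifs
    · rw [smul_mul_assoc, mul_smul_comm, ← add_smul, add_neg_cancel, zero_smul]
    · simp

/-- The star of a multiple of a letter is invertible for the shuffle product. -/
def starUnit (c : ℂ) (a : Letter) : Seriesˣ where
  val := seriesStar (c • letter a)
  inv := seriesStar (-c • letter a)
  val_inv := star_letter_mul_star_neg c a
  inv_val := by rw [mul_comm, star_letter_mul_star_neg]

theorem lder_starUnit_zpow (c : ℂ) (a b : Letter) (k : ℤ) :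
    lder b ((starUnit c a ^ k : Seriesˣ) : Series)
      = (if b = a then (k : ℂ) * c else 0) • ((starUnit c a ^ k : Seriesˣ) : Series) := by
  induction k using Int.induction_on with
  | zero => simp [lder_one]
  | succ n ih =>
    rw [zpow_add_one, Units.val_mul, lder_mul, ih]
    have : ((starUnit c a : Seriesˣ) : Series) = seriesStar (c • letter a) := rfl
    rw [this, lder_star_letter]
    split_ifs
    · simp only [smul_mul_assoc, mul_smul_comm, ← add_smul]
      congr 1; push_cast; ring
    · simp
  | pred n ih =>
    rw [zpow_sub_one, Units.val_mul, lder_mul, ih]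
    have : (((starUnit c a)⁻¹ : Seriesˣ) : Series) = seriesStar (-c • letter a) := rfl
    rw [this, lder_star_letter]
    split_ifs
    · simp only [smul_mul_assoc, mul_smul_comm, ← add_smul]
      congr 1; push_cast; ring
    · simp

/-! ### Noncommutative polynomials -/

/-- The alphabet is finite, so finite support amounts to bounded length. -/
theorem mem_polynomials_iff {S : Series} :
    S ∈ polynomials ↔ ∃ n : ℕ, ∀ w : List Letter, n ≤ w.length → S w = 0 := by
  constructor
  · intro h
    obtain ⟨n, hn⟩ := (Set.Finite.image List.length h).bddAbove
    refine ⟨n + 1, fun w hw => ?_⟩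
    by_contra hne
    have := hn ⟨w, hne, rfl⟩
    omega
  · rintro ⟨n, hn⟩
    refine (List.finite_length_lt Letter n).subset fun w hw => ?_
    by_contra h
    exact hw (hn w (not_lt.mp h))

theorem mul_eq_zero_of_length {S T : Series} {n m : ℕ} (hS : ∀ w : List Letter, n ≤ w.length → S w = 0)
    (hT : ∀ w : List Letter, m ≤ w.length → T w = 0) (w : List Letter) (hw : n + m ≤ w.length) :
    (S * T) w = 0 := by
  induction w generalizing S T n m with
  | nil =>
    rw [mul_nil, hS [] (by simp at hw ⊢; omega), zero_mul]
  | cons a w ih =>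
    simp only [List.length_cons] at hw
    rw [mul_cons]
    have h1 : (lder a S * T) w = 0 := by
      cases n with
      | zero =>
        have : lder a S = 0 := by ext v; exact hS _ (Nat.zero_le _)
        rw [this, zero_mul, zero_apply]
      | succ n => exact ih (n := n) (fun v hv => hS _ (by simpa using hv)) hT (by omega)
    have h2 : (S * lder a T) w = 0 := by
      cases m with
      | zero =>
        have : lder a T = 0 := by ext v; exact hT _ (Nat.zero_le _)
        rw [this, mul_zero, zero_apply]
      | succ m => exact ih (m := m) hS (fun v hv => hT _ (by simpa using hv)) (by omega)
    rw [h1, h2, add_zero]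

/-- The shuffle algebra `(ℂ⟨X⟩, ⧢, 1)` of noncommutative polynomials. -/
def Pol : Subalgebra ℂ Series where
  carrier := polynomials
  mul_mem' := by
    intro S T hS hT
    obtain ⟨n, hn⟩ := mem_polynomials_iff.1 hS
    obtain ⟨m, hm⟩ := mem_polynomials_iff.1 hT
    exact mem_polynomials_iff.2 ⟨n + m, mul_eq_zero_of_length hn hm⟩
  add_mem' := by
    intro S T hS hT
    obtain ⟨n, hn⟩ := mem_polynomials_iff.1 hS
    obtain ⟨m, hm⟩ := mem_polynomials_iff.1 hT
    refine mem_polynomials_iff.2 ⟨n + m, fun w hw => ?_⟩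
    rw [add_apply, hn w (by omega), hm w (by omega), add_zero]
  algebraMap_mem' := by
    intro c
    rw [Algebra.algebraMap_eq_smul_one]
    refine mem_polynomials_iff.2 ⟨1, fun w hw => ?_⟩
    cases w with
    | nil => simp at hw
    | cons a w => rw [smul_apply, one_cons, mul_zero]

theorem word_mem_Pol (w : List Letter) : word w ∈ Pol := by
  refine mem_polynomials_iff.2 ⟨w.length + 1, fun v hv => if_neg ?_⟩
  rintro rfl
  omega

/-- The word `w` as a polynomial. -/
def wordP (w : List Letter) : Pol := ⟨word w, word_mem_Pol w⟩

theorem wordP_nil : wordP [] = 1 := rfl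

/-- The support of a polynomial, with its coefficients. -/
def toFinsupp : Pol →ₗ[ℂ] (List Letter →₀ ℂ) where
  toFun P := Finsupp.ofSupportFinite P.1 P.2
  map_add' _ _ := by ext w; rfl
  map_smul' _ _ := by ext w; rfl

theorem toFinsupp_apply (P : Pol) (w : List Letter) : toFinsupp P w = P.1 w := rfl

theorem toFinsupp_wordP (w : List Letter) : toFinsupp (wordP w) = Finsupp.single w 1 := by
  ext v
  rw [toFinsupp_apply, Finsupp.single_apply]
  simp only [wordP, word, eq_comm]

theorem toFinsupp_injective : Function.Injective toFinsupp := by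
  intro P Q h
  apply Subtype.ext
  ext w
  exact DFunLike.congr_fun h w

theorem eq_sum_wordP (P : Pol) : P = (toFinsupp P).sum fun w c => c • wordP w := by
  apply toFinsupp_injective
  rw [map_finsuppSum]
  simp [toFinsupp_wordP]

theorem Pol.induction {p : Pol → Prop} (hw : ∀ w, p (wordP w)) (h0 : p 0)
    (hadd : ∀ P Q, p P → p Q → p (P + Q)) (hsmul : ∀ (c : ℂ) P, p P → p (c • P)) (P : Pol) :
    p P := by
  rw [eq_sum_wordP P, Finsupp.sum]
  exact Finset.sum_induction _ p hadd h0 fun w _ => hsmul _ _ (hw w)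

theorem Pol.linearMap_ext {M : Type*} [AddCommMonoid M] [Module ℂ M] {f g : Pol →ₗ[ℂ] M}
    (h : ∀ w, f (wordP w) = g (wordP w)) : f = g := by
  ext P
  induction P using Pol.induction with
  | hw w => exact h w
  | h0 => simp
  | hadd P Q hP hQ => rw [map_add, map_add, hP, hQ]
  | hsmul c P hP => rw [map_smul, map_smul, hP]

/-- `lder a` on polynomials. -/
def lderP (a : Letter) : Pol →ₗ[ℂ] Pol where
  toFun P := ⟨lder a P.1, by
    obtain ⟨n, hn⟩ := mem_polynomials_iff.1 P.2
    exact mem_polynomials_iff.2 ⟨n, fun w hw => hn _ (by simp; omega)⟩⟩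
  map_add' _ _ := rfl
  map_smul' _ _ := rfl

theorem lderP_mul (a : Letter) (P Q : Pol) : lderP a (P * Q) = lderP a P * Q + P * lderP a Q :=
  Subtype.ext (lder_mul P.1 Q.1 a)

theorem lderP_one (a : Letter) : lderP a 1 = 0 := Subtype.ext (lder_one a)

theorem lderP_wordP_cons (a b : Letter) (w : List Letter) :
    lderP a (wordP (b :: w)) = if a = b then wordP w else 0 := by
  apply Subtype.ext
  change lder a (word (b :: w)) = _
  rw [lder_word_cons]
  split_ifs <;> rfl

/-- The extra x₀ can be inserted at n + 1 places, all giving the same word. -/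
theorem wordP_zero_mul_replicate (n : ℕ) :
    wordP [0] * wordP (List.replicate n 0) = ((n : ℂ) + 1) • wordP (List.replicate (n + 1) 0) := by
  apply Subtype.ext
  change word [0] * word (List.replicate n 0) = ((n : ℂ) + 1) • word (List.replicate (n + 1) 0)
  induction n with
  | zero => simp [word_nil]
  | succ n ih =>
    refine ext_lder ?_ fun a => ?_
    · rw [mul_nil]
      simp [word, List.replicate_succ]
    · rw [lder_mul, lder_smul, List.replicate_succ (n := n + 1), lder_word_cons, lder_word_cons]
      by_cases h : a = 0
      · subst h
        rw [List.replicate_succ (n := n), lder_word_cons, ← List.replicate_succ]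
        simp only [if_true, ih, word_nil, one_mul]
        push_cast
        rw [add_smul ((n : ℂ) + 1), one_smul, add_comm]
      · rw [List.replicate_succ (n := n), lder_word_cons]
        simp [h]

theorem wordP_zero_pow (n : ℕ) :
    wordP [0] ^ n = (n.factorial : ℂ) • wordP (List.replicate n 0) := by
  induction n with
  | zero => simp [wordP_nil]
  | succ n ih =>
    rw [pow_succ', ih, mul_smul_comm, wordP_zero_mul_replicate, smul_smul, Nat.factorial_succ]
    congr 1
    push_cast
    ring

theorem wordP_replicate (n : ℕ) :
    wordP (List.replicate n 0) = ((n.factorial : ℂ)⁻¹) • wordP [0] ^ n := by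
  rw [wordP_zero_pow, smul_smul, inv_mul_cancel₀ (by exact_mod_cast n.factorial_ne_zero), one_smul]

/-- Both halves of a splitting of a word without x₁ are free of x₁: series supported on words
containing x₁ form a shuffle ideal. -/
theorem mul_eq_zero_of_notMem {S T : Series} (hS : ∀ w : List Letter, (1 : Letter) ∉ w → S w = 0)
    (w : List Letter) (hw : (1 : Letter) ∉ w) : (S * T) w = 0 := by
  induction w generalizing S T with
  | nil => rw [mul_nil, hS [] hw, zero_mul]
  | cons a w ih =>
    rw [List.mem_cons, not_or] at hw
    rw [mul_cons, ih hS hw.2, ih (S := lder a S) (fun v hv => hS _ ?_) hw.2, add_zero]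
    simp [hv, hw.1]

/-! ### Independence of the stars over the polynomials -/

/-- The locally nilpotent derivation `∂₀ + i ∂₁` of the shuffle algebra. -/
def twistDer : Module.End ℂ Series where
  toFun S := lder 0 S + Complex.I • lder 1 S
  map_add' S T := by simp only [lder_add, smul_add]; abel
  map_smul' c S := by simp only [lder_smul, smul_add, RingHom.id_apply, smul_comm c]

theorem twistDer_mul (S T : Series) : twistDer (S * T) = twistDer S * T + S * twistDer T := by
  change lder 0 (S * T) + Complex.I • lder 1 (S * T) = (lder 0 S + Complex.I • lder 1 S) * T
    + S * (lder 0 T + Complex.I • lder 1 T)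
  simp only [lder_mul, smul_add, add_mul, mul_add, smul_mul_assoc, mul_smul_comm]
  abel

/-- Each application lowers the bound on the length of the support by one. -/
theorem exists_twistDer_pow_eq_zero (P : Pol) : ∃ n : ℕ, (twistDer ^ n) P.1 = 0 := by
  obtain ⟨n, hn⟩ := mem_polynomials_iff.1 P.2
  refine ⟨n, ?_⟩
  generalize P.1 = S at hn
  induction n generalizing S with
  | zero => ext w; exact hn w (Nat.zero_le _)
  | succ n ih =>
    rw [pow_succ, Module.End.mul_apply]
    refine ih _ fun w hw => ?_
    change S (0 :: w) + Complex.I * S (1 :: w) = 0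
    rw [hn _ (by simpa using hw), hn _ (by simpa using hw), mul_zero, add_zero]

/-- By the Leibniz rule (D - c)(S E) = (D S) E, so nilpotency of D on P passes to D - c on P E. -/
theorem mul_mem_maxGenEigenspace (P : Pol) {E : Series} {c : ℂ} (hE : twistDer E = c • E) :
    P.1 * E ∈ twistDer.maxGenEigenspace c := by
  obtain ⟨n, hn⟩ := exists_twistDer_pow_eq_zero P
  rw [Module.End.mem_maxGenEigenspace]
  refine ⟨n, ?_⟩
  have key : ∀ (k : ℕ) (S : Series), ((twistDer - c • 1) ^ k) (S * E) = (twistDer ^ k) S * E := by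
    intro k
    induction k with
    | zero => intro S; rfl
    | succ k ih =>
      intro S
      rw [pow_succ, Module.End.mul_apply, pow_succ, Module.End.mul_apply, ← ih]
      congr 1
      rw [LinearMap.sub_apply, twistDer_mul, hE, mul_smul_comm]
      simp
  rw [key, hn, zero_mul]

/-- The monoid of exponents of `x₀*` and `x₁*`. -/
abbrev Expo : Type := Multiplicative ℤ × Multiplicative ℕ

/-- `(k, l) ↦ (x₀*)^k (x₁*)^l` for the shuffle product. -/
def starHom : Expo →* Seriesˣ :=
  (zpowersHom Seriesˣ (starUnit 1 0)).coprod (powersHom Seriesˣ (starUnit 1 1))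

theorem starHom_apply (e : Expo) :
    starHom e = starUnit 1 0 ^ (Multiplicative.toAdd e.1) * starUnit 1 1 ^ (Multiplicative.toAdd e.2) :=
  rfl

/-- The eigenvalue of `twistDer` on `(x₀*)^k (x₁*)^l`. -/
def expoEigenvalue (e : Expo) : ℂ :=
  ((Multiplicative.toAdd e.1 : ℤ) : ℂ) + Complex.I * ((Multiplicative.toAdd e.2 : ℕ) : ℂ)

/-- Real and imaginary parts recover k and l; this is the purpose of the factor i in `twistDer`. -/
theorem expoEigenvalue_injective : Function.Injective expoEigenvalue := by
  rintro ⟨k, l⟩ ⟨k', l'⟩ h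
  have hre := congrArg Complex.re h
  have him := congrArg Complex.im h
  simp only [expoEigenvalue, Complex.add_re, Complex.add_im, Complex.mul_re, Complex.mul_im,
    Complex.I_re, Complex.I_im, Complex.intCast_re, Complex.intCast_im, Complex.natCast_re,
    Complex.natCast_im] at hre him
  norm_num at hre him
  exact Prod.ext hre him

theorem twistDer_starHom (e : Expo) :
    twistDer (starHom e : Series) = expoEigenvalue e • (starHom e : Series) := by
  have h0 : twistDer ((starUnit 1 0 ^ (Multiplicative.toAdd e.1) : Seriesˣ) : Series) =
      ((Multiplicative.toAdd e.1 : ℤ) : ℂ) •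
        ((starUnit 1 0 ^ (Multiplicative.toAdd e.1) : Seriesˣ) : Series) := by
    change lder 0 _ + Complex.I • lder 1 _ = _
    rw [lder_starUnit_zpow, lder_starUnit_zpow]
    simp
  have h1 : twistDer ((starUnit 1 1 ^ (Multiplicative.toAdd e.2) : Seriesˣ) : Series) =
      (Complex.I * ((Multiplicative.toAdd e.2 : ℕ) : ℂ)) •
        ((starUnit 1 1 ^ (Multiplicative.toAdd e.2) : Seriesˣ) : Series) := by
    change lder 0 _ + Complex.I • lder 1 _ = _
    rw [← zpow_natCast, lder_starUnit_zpow, lder_starUnit_zpow]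
    simp [smul_smul]
  rw [starHom_apply, Units.val_mul, twistDer_mul, h0, h1, smul_mul_assoc, mul_smul_comm, ← add_smul]
  rfl

/-- The evaluation of `ℂ⟨X⟩[ℤ × ℕ]` at the stars. -/
def evalStars : MonoidAlgebra Pol Expo →ₐ[ℂ] Series :=
  MonoidAlgebra.liftNCAlgHom Pol.val ((Units.coeHom Series).comp starHom) fun _ _ => Commute.all _ _

theorem evalStars_single (e : Expo) (P : Pol) :
    evalStars (MonoidAlgebra.single e P) = P.1 * (starHom e : Series) :=
  MonoidAlgebra.liftNC_single _ _ _ _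

theorem evalStars_injective : Function.Injective evalStars := by
  rw [injective_iff_map_eq_zero]
  intro b hb
  have hind := (Module.End.independent_maxGenEigenspace twistDer).comp expoEigenvalue_injective
  have hsum : ∑ e ∈ b.coeff.support, (b.coeff e).1 * (starHom e : Series) = 0 := hb
  have hzero := (iSupIndep_iff_finsetSum_eq_zero_imp_eq_zero _).1 hind b.coeff.support
    (fun e => (b.coeff e).1 * (starHom e : Series))
    (fun e _ => mul_mem_maxGenEigenspace _ (twistDer_starHom e)) hsum
  ext e
  by_cases he : e ∈ b.coeff.support
  -- The power of the stars is a unit, so it can be cancelled.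
  · have := (Units.mul_left_eq_zero _).1 (hzero e he)
    simp [this]
  · simp [Finsupp.notMem_support_iff.1 he]

end Series

open Filter Topology Set MeasureTheory

/-! ### The cleft plane -/

theorem mem_Omega {z : ℂ} : z ∈ Omega ↔ ¬ (z.im = 0 ∧ (z.re ≤ 0 ∨ 1 ≤ z.re)) := Iff.rfl

theorem isOpen_Omega : IsOpen Omega := by
  have : IsClosed {z : ℂ | z.im = 0 ∧ (z.re ≤ 0 ∨ 1 ≤ z.re)} :=
    (isClosed_eq Complex.continuous_im continuous_const).inter
      ((isClosed_le Complex.continuous_re continuous_const).union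
        (isClosed_le continuous_const Complex.continuous_re))
  exact this.isOpen_compl

theorem ne_zero_of_mem_Omega {z : ℂ} (hz : z ∈ Omega) : z ≠ 0 := by
  rintro rfl
  exact hz (by simp)

theorem ne_one_of_mem_Omega {z : ℂ} (hz : z ∈ Omega) : z ≠ 1 := by
  rintro rfl
  exact hz (by simp)

theorem one_sub_ne_zero_of_mem_Omega {z : ℂ} (hz : z ∈ Omega) : 1 - z ≠ 0 :=
  sub_ne_zero.2 (ne_one_of_mem_Omega hz).symm

theorem mem_slitPlane_of_mem_Omega {z : ℂ} (hz : z ∈ Omega) : z ∈ Complex.slitPlane := by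
  rw [Complex.mem_slitPlane_iff]
  by_contra h
  rw [not_or, not_lt, not_not] at h
  exact hz ⟨h.2, Or.inl h.1⟩

theorem mul_mem_Omega {z : ℂ} (hz : z ∈ Omega) {t : ℝ} (ht : t ∈ Ioc (0 : ℝ) 1) :
    (t : ℂ) * z ∈ Omega := by
  rw [mem_Omega] at hz ⊢
  rintro ⟨him, hre⟩
  rw [Complex.im_ofReal_mul] at him
  rw [Complex.re_ofReal_mul] at hre
  refine hz ⟨(mul_eq_zero.1 him).resolve_left ht.1.ne', ?_⟩
  rcases hre with h | h
  · exact Or.inl (nonpos_of_mul_nonpos_right h ht.1)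
  · right
    nlinarith [ht.1, ht.2]

/-! ### Power bounds along the segments to `0` -/

/-- `g (t z) = O(t ^ p)` for `t ∈ ]0, 1]`, locally uniformly in `z ∈ Ω`. -/
def ScaleBound (p : ℝ) (g : ℂ → ℂ) : Prop :=
  ∀ z₀ ∈ Omega, ∃ C : ℝ, ∀ᶠ z in 𝓝 z₀, ∀ t ∈ Ioc (0 : ℝ) 1, ‖g (t * z)‖ ≤ C * t ^ p

namespace ScaleBound

theorem const (c : ℂ) : ScaleBound 0 fun _ => c :=
  fun _ _ => ⟨‖c‖, Eventually.of_forall fun _ t _ => by simp⟩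

theorem zero (p : ℝ) : ScaleBound p 0 :=
  fun _ _ => ⟨0, Eventually.of_forall fun _ t _ => by simp⟩

theorem add {p : ℝ} {f g : ℂ → ℂ} (hf : ScaleBound p f) (hg : ScaleBound p g) :
    ScaleBound p (f + g) := by
  intro z₀ hz₀
  obtain ⟨C, hC⟩ := hf z₀ hz₀
  obtain ⟨D, hD⟩ := hg z₀ hz₀
  refine ⟨C + D, ?_⟩
  filter_upwards [hC, hD] with z h1 h2 t ht
  calc ‖(f + g) (t * z)‖ ≤ ‖f (t * z)‖ + ‖g (t * z)‖ := norm_add_le _ _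
    _ ≤ C * t ^ p + D * t ^ p := add_le_add (h1 t ht) (h2 t ht)
    _ = (C + D) * t ^ p := by ring

theorem mul {p q : ℝ} {f g : ℂ → ℂ} (hf : ScaleBound p f) (hg : ScaleBound q g) :
    ScaleBound (p + q) (f * g) := by
  intro z₀ hz₀
  obtain ⟨C, hC⟩ := hf z₀ hz₀
  obtain ⟨D, hD⟩ := hg z₀ hz₀
  refine ⟨C * D, ?_⟩
  filter_upwards [hC, hD] with z h1 h2 t ht
  calc ‖(f * g) (t * z)‖ = ‖f (t * z)‖ * ‖g (t * z)‖ := norm_mul _ _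
    _ ≤ (C * t ^ p) * (D * t ^ q) :=
        mul_le_mul (h1 t ht) (h2 t ht) (norm_nonneg _) ((norm_nonneg _).trans (h1 t ht))
    _ = C * D * t ^ (p + q) := by rw [Real.rpow_add ht.1]; ring

theorem mono {p q : ℝ} {f : ℂ → ℂ} (hf : ScaleBound p f) (hqp : q ≤ p) : ScaleBound q f := by
  intro z₀ hz₀
  obtain ⟨C, hC⟩ := hf z₀ hz₀
  refine ⟨|C|, ?_⟩
  filter_upwards [hC] with z h1 t ht
  calc ‖f (t * z)‖ ≤ C * t ^ p := h1 t ht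
    _ ≤ |C| * t ^ q := mul_le_mul (le_abs_self C)
        (Real.rpow_le_rpow_of_exponent_ge ht.1 ht.2 hqp) (Real.rpow_nonneg ht.1.le _) (abs_nonneg _)

theorem smul {p : ℝ} {f : ℂ → ℂ} (hf : ScaleBound p f) (c : ℂ) : ScaleBound p (c • f) := by
  have := (const c).mul hf
  rwa [zero_add] at this

theorem pow {p : ℝ} {f : ℂ → ℂ} (hf : ScaleBound p f) (n : ℕ) : ScaleBound (n * p) (f ^ n) := by
  induction n with
  | zero =>
    rw [Nat.cast_zero, zero_mul, pow_zero]
    exact const 1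
  | succ n ih =>
    have := ih.mul hf
    rw [pow_succ]
    convert this using 1
    push_cast
    ring

theorem inv : ScaleBound (-1) fun s => s⁻¹ := by
  intro z₀ hz₀
  refine ⟨‖z₀⁻¹‖ + 1, ?_⟩
  have hcont : ContinuousAt (fun z : ℂ => ‖z⁻¹‖) z₀ :=
    (continuousAt_inv₀ (ne_zero_of_mem_Omega hz₀)).norm
  filter_upwards [hcont.eventually_le_const (lt_add_one _)] with z hz t ht
  rw [mul_inv, norm_mul, mul_comm, Real.rpow_neg_one]
  have : ‖((t : ℂ))⁻¹‖ = t⁻¹ := by rw [norm_inv, Complex.norm_of_nonneg ht.1.le]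
  rw [this]
  exact mul_le_mul_of_nonneg_right hz (inv_nonneg.2 ht.1.le)

/-- Compactness: 1 - tz has no zero for z in a closed ball inside Ω and t ∈ [0, 1], the value t = 0
included. -/
theorem inv_one_sub : ScaleBound 0 fun s => (1 - s)⁻¹ := by
  intro z₀ hz₀
  obtain ⟨r, hr, hsub⟩ := Metric.nhds_basis_closedBall.mem_iff.1 (isOpen_Omega.mem_nhds hz₀)
  have hK : IsCompact (Icc (0 : ℝ) 1 ×ˢ Metric.closedBall z₀ r) :=
    isCompact_Icc.prod (isCompact_closedBall z₀ r)
  have hc : ContinuousOn (fun x : ℝ × ℂ => (1 - (x.1 : ℂ) * x.2)⁻¹)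
      (Icc (0 : ℝ) 1 ×ˢ Metric.closedBall z₀ r) := by
    refine ContinuousOn.inv₀ (by fun_prop) ?_
    rintro ⟨t, z⟩ ⟨ht, hz⟩
    rcases ht.1.eq_or_lt with h | h
    · have h : t = 0 := h.symm
      simp [h]
    · exact one_sub_ne_zero_of_mem_Omega (mul_mem_Omega (hsub hz) ⟨h, ht.2⟩)
  obtain ⟨C, hC⟩ := hK.exists_bound_of_continuousOn hc
  refine ⟨C, ?_⟩
  filter_upwards [Metric.closedBall_mem_nhds z₀ hr] with z hz t ht
  rw [Real.rpow_zero, mul_one]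
  exact hC (t, z) ⟨⟨ht.1.le, ht.2⟩, hz⟩

/-- Here log(tz) = log t + log z, and t^ε |log t| ≤ 1/ε on ]0, 1]. -/
theorem log {ε : ℝ} (hε : 0 < ε) : ScaleBound (-ε) Complex.log := by
  intro z₀ hz₀
  refine ⟨1 / ε + (‖Complex.log z₀‖ + 1), ?_⟩
  have hcont : ContinuousAt (fun z : ℂ => ‖Complex.log z‖) z₀ :=
    (continuousAt_clog (mem_slitPlane_of_mem_Omega hz₀)).norm
  filter_upwards [hcont.eventually_le_const (lt_add_one _), isOpen_Omega.mem_nhds hz₀]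
    with z hz hzΩ t ht
  rw [Complex.log_ofReal_mul ht.1 (ne_zero_of_mem_Omega hzΩ), add_mul]
  have hpos : 0 < t ^ ε := Real.rpow_pos_of_pos ht.1 _
  refine (norm_add_le _ _).trans (add_le_add ?_ ?_)
  · have h := (Real.abs_log_mul_self_rpow_lt t ε ht.1 ht.2 hε).le
    rw [abs_mul, abs_of_pos hpos] at h
    rw [Complex.norm_real, Real.norm_eq_abs, Real.rpow_neg ht.1.le, ← div_eq_mul_inv,
      le_div_iff₀ hpos]
    exact h
  · refine hz.trans (le_mul_of_one_le_right (by positivity) ?_)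
    exact Real.one_le_rpow_of_pos_of_le_one_of_nonpos ht.1 ht.2 (by linarith)

/-- A function with zero derivative that tends to `0` at the end point `0` vanishes. -/
theorem eq_zero_of_deriv_eq_zero {p : ℝ} (hp : 0 < p) {f : ℂ → ℂ} (hf : ScaleBound p f)
    (hd : ∀ z ∈ Omega, HasDerivAt f 0 z) {z : ℂ} (hz : z ∈ Omega) : f z = 0 := by
  obtain ⟨C, hC⟩ := hf z hz
  have hC := hC.self_of_nhds
  have hray : ∀ t ∈ Ioc (0 : ℝ) 1, HasDerivAt (fun t : ℝ => f (t * z)) 0 t := by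
    intro t ht
    have h1 : HasDerivAt (fun s : ℂ => f (s * z)) (0 * (1 * z)) (t : ℂ) :=
      (hd _ (mul_mem_Omega hz ht)).comp (t : ℂ) ((hasDerivAt_id (t : ℂ)).mul_const z)
    rw [zero_mul] at h1
    exact h1.comp_ofReal
  -- `f` is constant on the segment from εz to z, so its value at z inherits the bound at εz.
  have hconst : ∀ ε ∈ Ioc (0 : ℝ) 1, ‖f z‖ ≤ C * ε ^ p := by
    intro ε hε
    have := constant_of_has_deriv_right_zero (f := fun t : ℝ => f (t * z)) (a := ε) (b := 1)
      (fun t ht => (hray t ⟨hε.1.trans_le ht.1, ht.2⟩).continuousAt.continuousWithinAt)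
      (fun t ht => (hray t ⟨hε.1.trans_le ht.1, ht.2.le⟩).hasDerivWithinAt) 1 ⟨hε.2, le_rfl⟩
    simp only [Complex.ofReal_one, one_mul] at this
    rw [this]
    exact hC ε hε
  have hlim : Tendsto (fun ε : ℝ => C * ε ^ p) (𝓝[>] 0) (𝓝 0) := by
    have h := ((Real.continuousAt_rpow_const 0 p (Or.inr hp.le)).tendsto.const_mul C)
    rw [Real.zero_rpow hp.ne', mul_zero] at h
    exact h.mono_left nhdsWithin_le_nhds
  have : ‖f z‖ ≤ 0 := ge_of_tendsto hlim (by
    filter_upwards [Ioc_mem_nhdsGT one_pos] with ε hε using hconst ε hε)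
  simpa using this

/-! ### Integration along the segments -/

/-- At tz the integrand is g(τtz) tz, bounded by a constant times t^(p+1) τ^p, and τ^p is integrable
since p > -1. -/
theorem segmentIntegral {p : ℝ} (hp : -1 < p) {g : ℂ → ℂ} (hg : ScaleBound p g) :
    ScaleBound (p + 1) (segmentIntegral g) := by
  intro z₀ hz₀
  obtain ⟨C, hC⟩ := hg z₀ hz₀
  refine ⟨C * (‖z₀‖ + 1) / (p + 1), ?_⟩
  filter_upwards [hC, continuous_norm.continuousAt.eventually_le_const (lt_add_one ‖z₀‖)]
    with z h1 hz t ht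
  have hC0 : 0 ≤ C := by simpa using (norm_nonneg _).trans (h1 1 ⟨one_pos, le_rfl⟩)
  have hint : IntervalIntegrable (fun τ : ℝ => C * (‖z₀‖ + 1) * t ^ (p + 1) * τ ^ p) volume 0 1 :=
    (intervalIntegral.intervalIntegrable_rpow' hp).const_mul _
  have hle : ‖Polylog.segmentIntegral g (t * z)‖
      ≤ ∫ τ in (0 : ℝ)..1, C * (‖z₀‖ + 1) * t ^ (p + 1) * τ ^ p := by
    refine intervalIntegral.norm_integral_le_of_norm_le zero_le_one ?_ hint
    refine Eventually.of_forall fun τ hτ => ?_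
    have hτt : τ * t ∈ Ioc (0 : ℝ) 1 := ⟨mul_pos hτ.1 ht.1, mul_le_one₀ hτ.2 ht.1.le ht.2⟩
    have h2 := h1 _ hτt
    rw [Real.mul_rpow hτ.1.le ht.1.le] at h2
    push_cast at h2
    rw [norm_mul, norm_mul, Complex.norm_of_nonneg ht.1.le, ← mul_assoc (τ : ℂ)]
    calc ‖g (τ * t * z)‖ * (t * ‖z‖) ≤ (C * (τ ^ p * t ^ p)) * (t * (‖z₀‖ + 1)) := by
          have := Real.rpow_nonneg hτ.1.le p
          have := Real.rpow_nonneg ht.1.le p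
          have := ht.1.le
          gcongr
      _ = C * (‖z₀‖ + 1) * t ^ (p + 1) * τ ^ p := by
          rw [Real.rpow_add ht.1, Real.rpow_one]; ring
  refine hle.trans (le_of_eq ?_)
  rw [intervalIntegral.integral_const_mul, integral_rpow (Or.inl hp), Real.one_rpow,
    Real.zero_rpow (by linarith)]
  ring

end ScaleBound

/-- The same expression is the t-derivative of t g(tz), which later allows it to be integrated in t.
-/
theorem hasDerivAt_ray {g : ℂ → ℂ} (hd : DifferentiableOn ℂ g Omega) {z : ℂ} (hz : z ∈ Omega)
    {t : ℝ} (ht : t ∈ Ioc (0 : ℝ) 1) :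
    HasDerivAt (fun w : ℂ => g (t * w) * w) (t * z * deriv g (t * z) + g (t * z)) z := by
  have h1 : HasDerivAt g (deriv g (t * z)) (t * z) :=
    (hd.differentiableAt (isOpen_Omega.mem_nhds (mul_mem_Omega hz ht))).hasDerivAt
  have h2 : HasDerivAt (fun w : ℂ => g (t * w) * w)
      (deriv g (t * z) * (t * 1) * z + g (t * z) * 1) z :=
    (h1.comp z ((hasDerivAt_id z).const_mul (t : ℂ))).mul (hasDerivAt_id z)
  exact h2.congr_deriv (by ring)

/-- The segment integral is a primitive. -/
theorem hasDerivAt_segmentIntegral {p : ℝ} (hp : -1 < p) {g : ℂ → ℂ}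
    (hd : DifferentiableOn ℂ g Omega) (hg : ScaleBound p g) {z₀ : ℂ} (hz₀ : z₀ ∈ Omega) :
    HasDerivAt (segmentIntegral g) (g z₀) z₀ := by
  obtain ⟨C, hC⟩ := hg z₀ hz₀
  obtain ⟨R, hR, hball⟩ := Metric.mem_nhds_iff.1
    (inter_mem (isOpen_Omega.mem_nhds hz₀) hC)
  have hΩ : ∀ z ∈ Metric.ball z₀ R, z ∈ Omega := fun z hz => (hball hz).1
  have hbd : ∀ z ∈ Metric.ball z₀ R, ∀ t ∈ Ioc (0 : ℝ) 1, ‖g (t * z)‖ ≤ C * t ^ p :=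
    fun z hz => (hball hz).2
  have hmem : ∀ z ∈ Omega, MapsTo (fun t : ℝ => (t : ℂ) * z) (Ioc 0 1) Omega :=
    fun z hz t ht => mul_mem_Omega hz ht
  have hcont : ∀ z ∈ Omega, ContinuousOn (fun t : ℝ => g (t * z)) (Ioc 0 1) := fun z hz =>
    hd.continuousOn.comp (by fun_prop) (hmem z hz)
  have hcont' : ContinuousOn (fun t : ℝ => deriv g (t * z₀)) (Ioc 0 1) :=
    (hd.deriv isOpen_Omega).continuousOn.comp (by fun_prop) (hmem z₀ hz₀)
  have hC0 : 0 ≤ C := by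
    simpa using (norm_nonneg _).trans (hbd z₀ (Metric.mem_ball_self hR) 1 ⟨one_pos, le_rfl⟩)
  have hrpow : IntervalIntegrable (fun t : ℝ => t ^ p) volume 0 1 :=
    intervalIntegral.intervalIntegrable_rpow' hp
  have hnorm : ∀ z ∈ Metric.ball z₀ R, ‖z‖ ≤ ‖z₀‖ + R := by
    intro z hz
    have := norm_sub_norm_le z z₀
    rw [Metric.mem_ball, dist_eq_norm] at hz
    linarith
  have hFbd : ∀ z ∈ Metric.ball z₀ R, ∀ t ∈ Ioc (0 : ℝ) 1,
      ‖g (t * z) * z‖ ≤ C * t ^ p * (‖z₀‖ + R) := by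
    intro z hz t ht
    rw [norm_mul]
    exact mul_le_mul (hbd z hz t ht) (hnorm z hz) (norm_nonneg _)
      (mul_nonneg hC0 (Real.rpow_nonneg ht.1.le _))
  have hmeas : ∀ z ∈ Omega, AEStronglyMeasurable (fun t : ℝ => g (t * z) * z)
      (volume.restrict (uIoc (0 : ℝ) 1)) := by
    intro z hz
    rw [uIoc_of_le zero_le_one]
    exact ((hcont z hz).mul continuousOn_const).aestronglyMeasurable measurableSet_Ioc
  -- Differentiation under the integral sign. The dominating function is Cauchy's estimate on
  -- circles of radius R/2, which stay inside the ball of radius R where the integrand is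
  -- controlled.
  have key := intervalIntegral.hasDerivAt_integral_of_dominated_loc_of_deriv_le
    (μ := volume) (a := 0) (b := 1) (𝕜 := ℂ)
    (F := fun z t => g (t * z) * z)
    (F' := fun z t => t * z * deriv g (t * z) + g (t * z)) (x₀ := z₀)
    (s := Metric.ball z₀ (R / 2)) (bound := fun t => C * (‖z₀‖ + R) / (R / 2) * t ^ p)
    (Metric.ball_mem_nhds z₀ (half_pos hR))
    (by filter_upwards [isOpen_Omega.mem_nhds hz₀] with z hz using hmeas z hz)
    (by
      refine (hrpow.const_mul (C * (‖z₀‖ + R))).mono_fun (hmeas z₀ hz₀) ?_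
      rw [uIoc_of_le zero_le_one]
      refine (ae_restrict_iff' measurableSet_Ioc).2 (Eventually.of_forall fun t ht => ?_)
      refine (hFbd z₀ (Metric.mem_ball_self hR) t ht).trans ((le_abs_self _).trans (le_of_eq ?_))
      rw [← Real.norm_eq_abs]
      congr 1
      ring)
    (by
      rw [uIoc_of_le zero_le_one]
      refine ContinuousOn.aestronglyMeasurable ?_ measurableSet_Ioc
      exact (ContinuousOn.mul (by fun_prop) hcont').add (hcont z₀ hz₀))
    (by
      refine Eventually.of_forall fun t ht z hz => ?_
      rw [uIoc_of_le zero_le_one] at ht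
      have hsub : Metric.closedBall z (R / 2) ⊆ Metric.ball z₀ R := by
        refine Metric.closedBall_subset_ball' ?_
        rw [Metric.mem_ball] at hz
        linarith
      rw [← (hasDerivAt_ray hd (hΩ z (hsub (Metric.mem_closedBall_self (half_pos hR).le)))
        ht).deriv]
      refine (Complex.norm_deriv_le_of_forall_mem_sphere_norm_le (half_pos hR)
        (C := C * t ^ p * (‖z₀‖ + R)) ?_ ?_).trans (le_of_eq ?_)
      · refine DifferentiableOn.diffContOnCl fun w hw => ?_
        rw [closure_ball _ (half_pos hR).ne'] at hw
        exact (hasDerivAt_ray hd (hΩ w (hsub hw)) ht).differentiableAt.differentiableWithinAt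
      · exact fun w hw => hFbd w (hsub (Metric.sphere_subset_closedBall hw)) t ht
      · ring)
    (hrpow.const_mul _)
    (by
      refine Eventually.of_forall fun t ht z hz => ?_
      rw [uIoc_of_le zero_le_one] at ht
      exact hasDerivAt_ray hd (hΩ z (Metric.ball_subset_ball (by linarith) hz)) ht)
  have hFTC : ∫ t in (0 : ℝ)..1, ((t : ℂ) * z₀ * deriv g (t * z₀) + g (t * z₀)) = g z₀ := by
    have := intervalIntegral.integral_eq_sub_of_hasDerivAt_of_le (zero_le_one' ℝ)
      (f := fun t : ℝ => (t : ℂ) * g (t * z₀))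
      (f' := fun t : ℝ => (t : ℂ) * z₀ * deriv g (t * z₀) + g (t * z₀)) ?_ ?_ key.1
    · rw [this]
      simp
    · intro t ht
      rcases ht.1.eq_or_lt with h | h
      · subst h
        -- At t = 0 the factor t kills whatever value `g` takes at 0, and t g(t z₀) = O(t^(p+1))
        -- with p + 1 > 0 gives continuity there.
        have hlim : Tendsto (fun t : ℝ => C * t ^ (p + 1)) (𝓝[Icc 0 1] 0) (𝓝 0) := by
          have h := (Real.continuousAt_rpow_const 0 (p + 1) (Or.inr (by linarith))).tendsto.const_mul C
          rw [Real.zero_rpow (by linarith), mul_zero] at h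
          exact h.mono_left nhdsWithin_le_nhds
        rw [ContinuousWithinAt, Complex.ofReal_zero, zero_mul]
        refine squeeze_zero_norm' ?_ hlim
        filter_upwards [self_mem_nhdsWithin] with t ht
        rcases ht.1.eq_or_lt with h | h
        · subst h
          simp [Real.zero_rpow (show p + 1 ≠ 0 by linarith)]
        · rw [norm_mul, Complex.norm_of_nonneg ht.1, Real.rpow_add h, Real.rpow_one]
          have := hbd z₀ (Metric.mem_ball_self hR) t ⟨h, ht.2⟩
          nlinarith
      · have hΩt := mul_mem_Omega hz₀ ⟨h, ht.2⟩
        have hg : ContinuousAt g (t * z₀) :=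
          (hd.differentiableAt (isOpen_Omega.mem_nhds hΩt)).continuousAt
        have : ContinuousAt (fun t : ℝ => g (t * z₀)) t :=
          ContinuousAt.comp (f := fun t : ℝ => (t : ℂ) * z₀) hg (by fun_prop)
        exact (Complex.continuous_ofReal.continuousAt.mul this).continuousWithinAt
    · intro t ht
      have hΩt := mul_mem_Omega hz₀ ⟨ht.1, ht.2.le⟩
      have h1 : HasDerivAt g (deriv g (t * z₀)) ((t : ℂ) * z₀) :=
        (hd.differentiableAt (isOpen_Omega.mem_nhds hΩt)).hasDerivAt
      have h2 : HasDerivAt (fun s : ℂ => s * g (s * z₀))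
          ((t : ℂ) * z₀ * deriv g (t * z₀) + g (t * z₀)) (t : ℂ) := by
        have h3 : HasDerivAt (fun s : ℂ => s * g (s * z₀))
            (1 * g (t * z₀) + t * (deriv g (t * z₀) * (1 * z₀))) (t : ℂ) :=
          (hasDerivAt_id (t : ℂ)).mul
            (h1.comp (t : ℂ) ((hasDerivAt_id (t : ℂ)).mul_const z₀))
        exact h3.congr_deriv (by ring)
      exact h2.comp_ofReal
  have := key.2
  rw [hFTC] at this
  exact this

/-! ### Polylogarithms of words -/

/-- The densities of the forms `ω₀ = ds / s` and `ω₁ = ds / (1 - s)`. -/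
def form (a : Letter) (z : ℂ) : ℂ := if a = 1 then (1 - z)⁻¹ else z⁻¹

theorem form_zero : form 0 = fun z => z⁻¹ := rfl

theorem form_one : form 1 = fun z => (1 - z)⁻¹ := rfl

theorem eq_zero_of_ne_one {a : Letter} (h : a ≠ 1) : a = 0 := by
  fin_cases a
  · rfl
  · exact absurd rfl h

theorem differentiableOn_form (a : Letter) : DifferentiableOn ℂ (form a) Omega := by
  intro z hz
  have h0 := ne_zero_of_mem_Omega hz
  have h1 := one_sub_ne_zero_of_mem_Omega hz
  refine DifferentiableAt.differentiableWithinAt ?_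
  by_cases h : a = 1
  · subst h
    rw [form_one]
    fun_prop (disch := assumption)
  · rw [eq_zero_of_ne_one h, form_zero]
    fun_prop (disch := assumption)

theorem Li_nil (z : ℂ) : Li [] z = 1 := by rw [Li]

theorem Li_of_notMem {w : List Letter} (hw : (1 : Letter) ∉ w) :
    Li w = ((w.length.factorial : ℂ)⁻¹) • Complex.log ^ w.length := by
  funext z
  cases w with
  | nil => simp [Li_nil]
  | cons a w =>
    rw [List.mem_cons, not_or] at hw
    rw [Li, if_neg (Ne.symm hw.1), if_neg hw.2, List.length_cons, Pi.smul_apply, Pi.pow_apply,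
      smul_eq_mul, div_eq_inv_mul]

theorem Li_cons_of_mem {a : Letter} {w : List Letter} (h : (1 : Letter) ∈ a :: w) :
    Li (a :: w) = segmentIntegral (form a * Li w) := by
  funext z
  rw [Li]
  by_cases ha : a = 1
  · rw [if_pos ha]
    congr 1
    funext s
    rw [Pi.mul_apply, ha, form_one, div_eq_inv_mul]
  · rw [if_neg ha, if_pos ((List.mem_cons.1 h).resolve_left (Ne.symm ha))]
    congr 1
    funext s
    rw [Pi.mul_apply, eq_zero_of_ne_one ha, form_zero, div_eq_inv_mul]

theorem scaleBound_Li_of_notMem {w : List Letter} (hw : (1 : Letter) ∉ w) :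
    ScaleBound (-1 / 4) (Li w) := by
  rw [Li_of_notMem hw]
  -- With n the length, this choice makes nε ≤ 1/4.
  have hε : (0 : ℝ) < 1 / (4 * (w.length + 1)) := by positivity
  refine (((ScaleBound.log hε).pow w.length).smul _).mono ?_
  rw [mul_neg, neg_div, neg_le_neg_iff, mul_one_div]
  rw [div_le_div_iff₀ (by positivity) (by norm_num)]
  linarith

/-- The exponents reproduce themselves: ω₁ keeps -1/4, while ω₀ only meets words containing x₁ and
gives 3/4 - 1 = -1/4; integration then adds 1. -/
theorem Li_cons_aux {a : Letter} {w : List Letter} (h : (1 : Letter) ∈ a :: w)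
    (hd : DifferentiableOn ℂ (Li w) Omega) (hb : ScaleBound (-1 / 4) (Li w))
    (hb' : (1 : Letter) ∈ w → ScaleBound (3 / 4) (Li w)) :
    ScaleBound (3 / 4) (Li (a :: w)) ∧
      ∀ z ∈ Omega, HasDerivAt (Li (a :: w)) (form a z * Li w z) z := by
  have hg : ScaleBound (-1 / 4) (form a * Li w) := by
    by_cases ha : a = 1
    · rw [ha, form_one]
      exact (ScaleBound.inv_one_sub.mul hb).mono (by norm_num)
    · rw [eq_zero_of_ne_one ha, form_zero]
      exact (ScaleBound.inv.mul (hb' ((List.mem_cons.1 h).resolve_left (Ne.symm ha)))).mono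
        (by norm_num)
  rw [Li_cons_of_mem h]
  exact ⟨(ScaleBound.segmentIntegral (by norm_num) hg).mono (by norm_num), fun z hz =>
    hasDerivAt_segmentIntegral (by norm_num) ((differentiableOn_form a).mul hd) hg hz⟩

theorem hasDerivAt_Li_cons_of_notMem {a : Letter} {w : List Letter} (h : (1 : Letter) ∉ a :: w)
    {z : ℂ} (hz : z ∈ Omega) : HasDerivAt (Li (a :: w)) (form a z * Li w z) z := by
  have hw : (1 : Letter) ∉ w := fun h' => h (List.mem_cons_of_mem _ h')
  have ha : a = 0 := eq_zero_of_ne_one fun h' => h (h' ▸ List.mem_cons_self)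
  rw [Li_of_notMem h, Li_of_notMem hw, ha, form_zero, List.length_cons]
  refine (((Complex.hasDerivAt_log (mem_slitPlane_of_mem_Omega hz)).pow
    (w.length + 1)).const_smul _).congr_deriv ?_
  have hf : (w.length.factorial : ℂ) ≠ 0 := by exact_mod_cast w.length.factorial_ne_zero
  have hn : (w.length : ℂ) + 1 ≠ 0 := by exact_mod_cast w.length.succ_ne_zero
  have hz0 := ne_zero_of_mem_Omega hz
  simp only [Nat.factorial_succ, Pi.smul_apply, Pi.pow_apply, smul_eq_mul, Nat.add_sub_cancel]
  push_cast
  field_simp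

/-- The bounds must be proved together: prefixing x₁ uses the weak one, prefixing x₀ to a word with
x₁ the strong one. -/
theorem Li_regularity (w : List Letter) : DifferentiableOn ℂ (Li w) Omega ∧
    ScaleBound (-1 / 4) (Li w) ∧ ((1 : Letter) ∈ w → ScaleBound (3 / 4) (Li w)) := by
  induction w with
  | nil =>
    refine ⟨?_, scaleBound_Li_of_notMem (by simp), by simp⟩
    have : Li [] = fun _ => 1 := funext Li_nil
    rw [this]
    exact differentiableOn_const _
  | cons a w ih =>
    by_cases h : (1 : Letter) ∈ a :: w
    · obtain ⟨h1, h2⟩ := Li_cons_aux h ih.1 ih.2.1 ih.2.2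
      exact ⟨fun z hz => (h2 z hz).differentiableAt.differentiableWithinAt,
        h1.mono (by norm_num), fun _ => h1⟩
    · exact ⟨fun z hz =>
        (hasDerivAt_Li_cons_of_notMem h hz).differentiableAt.differentiableWithinAt,
        scaleBound_Li_of_notMem h, fun h' => absurd h' h⟩

theorem hasDerivAt_Li_cons (a : Letter) (w : List Letter) {z : ℂ} (hz : z ∈ Omega) :
    HasDerivAt (Li (a :: w)) (form a z * Li w z) z := by
  by_cases h : (1 : Letter) ∈ a :: w
  · obtain ⟨h1, h2, h3⟩ := Li_regularity w
    exact (Li_cons_aux h h1 h2 h3).2 z hz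
  · exact hasDerivAt_Li_cons_of_notMem h hz

/-! ### Polylogarithms of polynomials -/

/-- The linear extension of `w ↦ Li_w` to polynomials. -/
def LiPol : Pol →ₗ[ℂ] (ℂ → ℂ) := (Finsupp.linearCombination ℂ Li).comp toFinsupp

theorem LiPol_wordP (w : List Letter) : LiPol (wordP w) = Li w := by
  rw [LiPol, LinearMap.comp_apply, toFinsupp_wordP, Finsupp.linearCombination_single, one_smul]

theorem differentiableOn_LiPol (P : Pol) : DifferentiableOn ℂ (LiPol P) Omega := by
  induction P using Pol.induction with
  | hw w =>
    rw [LiPol_wordP]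
    exact (Li_regularity w).1
  | h0 =>
    rw [map_zero]
    exact differentiableOn_const _
  | hadd P Q hP hQ =>
    rw [map_add]
    exact hP.add hQ
  | hsmul c P hP =>
    rw [map_smul]
    exact hP.const_smul c

/-- Through polylogarithms, d/dz becomes the combination of the two letter derivations with
coefficients 1/z and 1/(1 - z). -/
theorem hasDerivAt_LiPol (P : Pol) {z : ℂ} (hz : z ∈ Omega) : HasDerivAt (LiPol P)
    (form 0 z * LiPol (lderP 0 P) z + form 1 z * LiPol (lderP 1 P) z) z := by
  induction P using Pol.induction with
  | hw w =>
    cases w with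
    | nil =>
      rw [LiPol_wordP, wordP_nil, lderP_one, lderP_one, show Li [] = fun _ => 1 from funext Li_nil]
      exact (hasDerivAt_const z (1 : ℂ)).congr_deriv (by simp)
    | cons a w =>
      rw [LiPol_wordP, lderP_wordP_cons, lderP_wordP_cons]
      refine (hasDerivAt_Li_cons a w hz).congr_deriv ?_
      fin_cases a <;> simp [LiPol_wordP]
  | h0 =>
    simp only [map_zero]
    exact (hasDerivAt_const z (0 : ℂ)).congr_deriv (by simp)
  | hadd P Q hP hQ =>
    simp only [map_add]
    refine (hP.add hQ).congr_deriv ?_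
    simp only [Pi.add_apply]
    ring
  | hsmul c P hP =>
    simp only [map_smul]
    refine (hP.const_smul c).congr_deriv ?_
    simp only [Pi.smul_apply, smul_eq_mul]
    ring

theorem scaleBound_LiPol {P : Pol} (hP : ∀ w : List Letter, (1 : Letter) ∉ w → P.1 w = 0) :
    ScaleBound (3 / 4) (LiPol P) := by
  rw [LiPol, LinearMap.comp_apply, Finsupp.linearCombination_apply, Finsupp.sum]
  refine Finset.sum_induction _ (ScaleBound (3 / 4)) (fun _ _ => ScaleBound.add)
    (ScaleBound.zero _) fun w hw => ((Li_regularity w).2.2 ?_).smul _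
  by_contra h
  exact Finsupp.mem_support_iff.1 hw (hP w h)

/-! ### The shuffle relation for polylogarithms -/

theorem wordP_apply_of_notMem {w v : List Letter} (hw : (1 : Letter) ∈ w) (hv : (1 : Letter) ∉ v) :
    (wordP w).1 v = 0 :=
  show (if v = w then (1 : ℂ) else 0) = 0 from if_neg fun h : v = w => hv (h ▸ hw)

theorem eq_replicate_of_notMem {w : List Letter} (hw : (1 : Letter) ∉ w) :
    w = List.replicate w.length 0 :=
  List.eq_replicate_of_mem fun b hb => eq_zero_of_ne_one fun h : b = 1 => hw (h ▸ hb)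

theorem LiPol_replicate (n : ℕ) : LiPol (wordP (List.replicate n 0))
    = ((n.factorial : ℂ)⁻¹) • Complex.log ^ n := by
  rw [LiPol_wordP, Li_of_notMem (by simp [List.mem_replicate]), List.length_replicate]

theorem LiPol_wordP_zero_pow (n : ℕ) : LiPol (wordP [0] ^ n) = Complex.log ^ n := by
  rw [wordP_zero_pow, map_smul, LiPol_replicate, smul_smul,
    mul_inv_cancel₀ (by exact_mod_cast n.factorial_ne_zero), one_smul]

/-- The shuffle relation for powers of the logarithm. -/
theorem LiPol_replicate_mul (n m : ℕ) :
    LiPol (wordP (List.replicate n 0) * wordP (List.replicate m 0))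
      = LiPol (wordP (List.replicate n 0)) * LiPol (wordP (List.replicate m 0)) := by
  rw [wordP_replicate, wordP_replicate, smul_mul_smul_comm, ← pow_add, map_smul, map_smul, map_smul,
    LiPol_wordP_zero_pow, LiPol_wordP_zero_pow, LiPol_wordP_zero_pow, smul_mul_smul_comm, pow_add]

/-- The product has exponent 3/4 - 1/4; every word of u ⧢ v contains x₁, so the other term has
exponent 3/4. A positive exponent forces the limit 0 at the origin. -/
theorem scaleBound_shuffle_defect {u v : List Letter} (hu : (1 : Letter) ∈ u) :
    ScaleBound (1 / 2) (LiPol (wordP u) * LiPol (wordP v) + (-1 : ℂ) • LiPol (wordP u * wordP v)) := by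
  refine ScaleBound.add ?_ (ScaleBound.smul (ScaleBound.mono (scaleBound_LiPol ?_) (by norm_num)) _)
  · rw [LiPol_wordP, LiPol_wordP]
    exact (((Li_regularity u).2.2 hu).mul (Li_regularity v).2.1).mono (by norm_num)
  · exact fun w hw => mul_eq_zero_of_notMem (fun w hw => wordP_apply_of_notMem hu hw) w hw

theorem LiPol_mul_wordP (n : ℕ) (u v : List Letter) (hn : u.length + v.length ≤ n) {z : ℂ}
    (hz : z ∈ Omega) :
    LiPol (wordP u * wordP v) z = LiPol (wordP u) z * LiPol (wordP v) z := by
  induction n generalizing u v z with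
  | zero =>
    have hu : u = [] := List.eq_nil_of_length_eq_zero (by omega)
    rw [hu, wordP_nil, one_mul, ← wordP_nil, LiPol_wordP [], Li_nil, one_mul]
  | succ n ih =>
    cases u with
    | nil => rw [wordP_nil, one_mul, ← wordP_nil, LiPol_wordP [], Li_nil, one_mul]
    | cons a u =>
      cases v with
      | nil => rw [wordP_nil, mul_one, ← wordP_nil, LiPol_wordP [], Li_nil, mul_one]
      | cons b v =>
        simp only [List.length_cons] at hn
        by_cases h : (1 : Letter) ∈ a :: u ∨ (1 : Letter) ∈ b :: v
        · have hsb : ScaleBound (1 / 2) (LiPol (wordP (a :: u)) * LiPol (wordP (b :: v))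
              + (-1 : ℂ) • LiPol (wordP (a :: u) * wordP (b :: v))) := by
            rcases h with h | h
            · exact scaleBound_shuffle_defect h
            · rw [mul_comm (wordP _), mul_comm (LiPol _)]
              exact scaleBound_shuffle_defect h
          have hder : ∀ s ∈ Omega, HasDerivAt (LiPol (wordP (a :: u)) * LiPol (wordP (b :: v))
              + (-1 : ℂ) • LiPol (wordP (a :: u) * wordP (b :: v))) 0 s := by
            intro s hs
            refine (((hasDerivAt_LiPol _ hs).mul (hasDerivAt_LiPol _ hs)).add
              ((hasDerivAt_LiPol _ hs).const_smul (-1 : ℂ))).congr_deriv ?_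
            -- By the Leibniz rules on both sides, the derivative involves only the defects of the
            -- pairs with one first letter removed.
            have h1 := ih u (b :: v) (by simp; omega) hs
            have h2 := ih (a :: u) v (by simp; omega) hs
            simp only [lderP_mul, lderP_wordP_cons, map_add, Pi.add_apply, smul_eq_mul]
            fin_cases a <;> fin_cases b <;> simp at h1 h2 ⊢ <;> rw [h1, h2] <;> ring
          have := hsb.eq_zero_of_deriv_eq_zero (by norm_num) hder hz
          simp only [Pi.add_apply, Pi.mul_apply, Pi.smul_apply, smul_eq_mul] at this
          linear_combination -this
        -- Without x₁ the defect need not tend to 0 a priori, but both words are powers of x₀.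
        · rw [not_or] at h
          rw [eq_replicate_of_notMem h.1, eq_replicate_of_notMem h.2, LiPol_replicate_mul]
          rfl

/-- `P ↦ Li_P` as a linear map into `H(Ω)`. -/
def LiLin : Pol →ₗ[ℂ] HOmega where
  toFun P := ⟨fun z => LiPol P z, LiPol P,
    (differentiableOn_LiPol P).analyticOnNhd isOpen_Omega, fun _ => rfl⟩
  map_add' P Q := by
    apply Subtype.ext
    funext z
    simp
  map_smul' c P := by
    apply Subtype.ext
    funext z
    simp

theorem LiLin_apply (P : Pol) (z : Omega) : (LiLin P : Omega → ℂ) z = LiPol P z := rfl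

theorem LiLin_mul (P Q : Pol) : LiLin (P * Q) = LiLin P * LiLin Q := by
  induction P using Pol.induction with
  | hw u =>
    induction Q using Pol.induction with
    | hw v =>
      apply Subtype.ext
      funext z
      exact LiPol_mul_wordP _ u v le_rfl z.2
    | h0 => simp
    | hadd Q R hQ hR => rw [mul_add, map_add, hQ, hR, map_add, mul_add]
    | hsmul c Q hQ => rw [mul_smul_comm, map_smul, hQ, map_smul, mul_smul_comm]
  | h0 => simp
  | hadd P R hP hR => rw [add_mul, map_add, hP, hR, map_add, add_mul]
  | hsmul c P hP => rw [smul_mul_assoc, map_smul, hP, map_smul, smul_mul_assoc]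

theorem LiLin_one : LiLin 1 = 1 := by
  apply Subtype.ext
  funext z
  rw [LiLin_apply, ← wordP_nil, LiPol_wordP, Li_nil]
  rfl

/-- The morphism `(ℂ⟨X⟩, ⧢, 1) → H(Ω)` given by the polylogarithms. -/
def LiHom : Pol →ₐ[ℂ] HOmega := AlgHom.ofLinearMap LiLin LiLin_one LiLin_mul

/-! ### The morphism on the extended algebra -/

/-- The analytic function `z ↦ z`, invertible on `Ω`. -/
def coordUnit : HOmegaˣ where
  val := ⟨fun z => z, id, analyticOnNhd_id, fun _ => rfl⟩
  inv := ⟨fun z => (z : ℂ)⁻¹, fun z => z⁻¹,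
    analyticOnNhd_id.inv fun _ hz => ne_zero_of_mem_Omega hz, fun _ => rfl⟩
  val_inv := by
    apply Subtype.ext
    funext z
    exact mul_inv_cancel₀ (ne_zero_of_mem_Omega z.2)
  inv_val := by
    apply Subtype.ext
    funext z
    exact inv_mul_cancel₀ (ne_zero_of_mem_Omega z.2)

/-- The analytic function `z ↦ 1 / (1 - z)`. -/
def invOneSub : HOmega :=
  ⟨fun z => (1 - (z : ℂ))⁻¹, fun z => (1 - z)⁻¹,
    (analyticOnNhd_const.sub analyticOnNhd_id).inv fun _ hz => one_sub_ne_zero_of_mem_Omega hz,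
    fun _ => rfl⟩

/-- `(k, l) ↦ z ^ k (1 - z) ^ (-l)`. -/
def functionHom : Expo →* HOmega :=
  ((Units.coeHom HOmega).comp (zpowersHom HOmegaˣ coordUnit)).coprod (powersHom HOmega invOneSub)

/-- The morphism `ℂ⟨X⟩[ℤ × ℕ] → H(Ω)`. -/
def evalFunctions : MonoidAlgebra Pol Expo →ₐ[ℂ] HOmega :=
  MonoidAlgebra.liftNCAlgHom LiHom functionHom fun _ _ => Commute.all _ _

theorem evalFunctions_single (e : Expo) (P : Pol) :
    evalFunctions (MonoidAlgebra.single e P) = LiLin P * functionHom e :=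
  MonoidAlgebra.liftNC_single _ _ _ _

theorem evalStars_single_one (P : Pol) : evalStars (MonoidAlgebra.single 1 P) = P.1 := by
  rw [evalStars_single, map_one, Units.val_one, mul_one]

theorem evalStars_x0star :
    evalStars (MonoidAlgebra.single (Multiplicative.ofAdd 1, 1) 1) = x0star.1 := by
  rw [evalStars_single, starHom_apply]
  simp [starUnit, x0star]

theorem evalStars_negx0star :
    evalStars (MonoidAlgebra.single (Multiplicative.ofAdd (-1), 1) 1) = negx0star.1 := by
  rw [evalStars_single, starHom_apply]
  simp [starUnit, negx0star]

theorem evalStars_x1star :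
    evalStars (MonoidAlgebra.single (1, Multiplicative.ofAdd 1) 1) = x1star.1 := by
  rw [evalStars_single, starHom_apply]
  simp [starUnit, x1star]

/-- This inclusion is what allows the inverse of the injective `evalStars` to be applied to the
whole of `extAlgebra`. -/
theorem extAlgebra_le_range : extAlgebra ≤ evalStars.range := by
  refine Algebra.adjoin_le ?_
  rintro S (hS | hS | hS | hS)
  · exact ⟨_, evalStars_single_one ⟨S, hS⟩⟩
  · exact ⟨_, evalStars_x0star.trans hS.symm⟩
  · exact ⟨_, evalStars_negx0star.trans hS.symm⟩
  · exact ⟨_, evalStars_x1star.trans hS.symm⟩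

/-- The extension of `w ↦ Li_w` to `ℂ⟨X⟩[x₀*, (-x₀)*, x₁*]`. -/
def polylogHom : extAlgebra →ₐ[ℂ] HOmega :=
  (evalFunctions.comp (AlgEquiv.ofInjective evalStars evalStars_injective).symm.toAlgHom).comp
    (Subalgebra.inclusion extAlgebra_le_range)

theorem polylogHom_eq {S : extAlgebra} {b : MonoidAlgebra Pol Expo} (h : evalStars b = S.1) :
    polylogHom S = evalFunctions b := by
  have : Subalgebra.inclusion extAlgebra_le_range S
      = AlgEquiv.ofInjective evalStars evalStars_injective b := Subtype.ext h.symm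
  change evalFunctions ((AlgEquiv.ofInjective evalStars evalStars_injective).symm
    (Subalgebra.inclusion extAlgebra_le_range S)) = _
  rw [this, AlgEquiv.symm_apply_apply]

theorem polylogHom_wordE (w : List Letter) : polylogHom (wordE w) = LiLin (wordP w) := by
  rw [polylogHom_eq (S := wordE w) (evalStars_single_one (wordP w)), evalFunctions_single, map_one,
    mul_one]

theorem polylogHom_x0star : polylogHom x0star = coordUnit := by
  rw [polylogHom_eq evalStars_x0star, evalFunctions_single, LiLin_one, one_mul]
  simp [functionHom]

theorem polylogHom_negx0star : polylogHom negx0star = (coordUnit⁻¹ : HOmegaˣ) := by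
  rw [polylogHom_eq evalStars_negx0star, evalFunctions_single, LiLin_one, one_mul]
  simp [functionHom]

theorem polylogHom_x1star : polylogHom x1star = invOneSub := by
  rw [polylogHom_eq evalStars_x1star, evalFunctions_single, LiLin_one, one_mul]
  simp [functionHom]

theorem Pol_le_extAlgebra : Pol ≤ extAlgebra := fun _ hS => Algebra.subset_adjoin (Or.inl hS)

/-- A morphism on `ℂ⟨X⟩[x₀*, (-x₀)*, x₁*]` is determined by the words and the three stars. -/
theorem extAlgebra_algHom_ext {A : Type*} [Semiring A] [Algebra ℂ A] {f g : extAlgebra →ₐ[ℂ] A}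
    (hw : ∀ w, f (wordE w) = g (wordE w)) (h0 : f x0star = g x0star)
    (hn : f negx0star = g negx0star) (h1 : f x1star = g x1star) : f = g := by
  refine AlgHom.adjoin_ext ?_
  rintro S hmem
  rcases hmem with hS | hS | hS | hS
  · have : (f.comp (Subalgebra.inclusion Pol_le_extAlgebra)).toLinearMap
        = (g.comp (Subalgebra.inclusion Pol_le_extAlgebra)).toLinearMap :=
      Pol.linearMap_ext hw
    exact LinearMap.congr_fun this ⟨S, hS⟩
  · subst hS
    exact h0
  · subst hS
    exact hn
  · rw [Set.mem_singleton_iff] at hS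
    subst hS
    exact h1

end Polylog

end

/-! ### Existence and uniqueness of the extended morphism -/

theorem mainTheorem7 :
    ∃! μ : Polylog.Series.extAlgebra →ₐ[ℂ] Polylog.HOmega,
      (∀ (w : List Polylog.Letter) (z : Polylog.Omega),
        (μ (Polylog.wordE w) : Polylog.Omega → ℂ) z = Polylog.Li w z) ∧
      (∀ z : Polylog.Omega, (μ Polylog.x0star : Polylog.Omega → ℂ) z = (z : ℂ)) ∧
      (∀ z : Polylog.Omega, (μ Polylog.negx0star : Polylog.Omega → ℂ) z = 1 / (z : ℂ)) ∧
      (∀ z : Polylog.Omega, (μ Polylog.x1star : Polylog.Omega → ℂ) z = 1 / (1 - (z : ℂ))) := by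
  refine ⟨Polylog.polylogHom, ⟨fun w z => ?_, fun z => ?_, fun z => ?_, fun z => ?_⟩, ?_⟩
  · rw [Polylog.polylogHom_wordE, Polylog.LiLin_apply, Polylog.LiPol_wordP]
  · rw [Polylog.polylogHom_x0star]
    rfl
  · rw [Polylog.polylogHom_negx0star, one_div]
    rfl
  · rw [Polylog.polylogHom_x1star, one_div]
    rfl
  · rintro ν ⟨hw, h0, hn, h1⟩
    refine Polylog.extAlgebra_algHom_ext (fun w => ?_) ?_ ?_ ?_ <;>
      refine Subtype.ext (funext fun z => ?_)
    · rw [hw, Polylog.polylogHom_wordE, Polylog.LiLin_apply, Polylog.LiPol_wordP]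
    · rw [h0, Polylog.polylogHom_x0star]
      rfl
    · rw [hn, Polylog.polylogHom_negx0star, one_div]
      rfl
    · rw [h1, Polylog.polylogHom_x1star, one_div]
      rfl
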